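/- **Theorem 4.7** ($\mathbf{GL.3}^{\mathbf{as}}=\mathbf{GL.3}$). Modal formulas are built from propositional variables $p_0,p_1,\dots$ with $\bot,\to,\Box$. A normal modal logic is a set of formulas that contains all propositional tautologies and $\Box(p\to q)\to(\Box p\to\Box q)$ and is closed under modus ponens, under $\varphi\mapsto\Box\varphi$ and under substitution of formulas for variables. $\mathbf{GL.3}$ is the least normal modal logic that contains $\Box(\Box p\to p)\to\Box p$ and $\Box(p\wedge\Box p\to q)\vee\Box(q\wedge\Box q\to p)$. A frame is a pair $(X,R)$ with $X\neq\varnothing$ and $R\subseteq X\times X$; it is a $\mathbf{GL.3}$-frame if all formulas of $\mathbf{GL.3}$ are valid in it, and it is connected if any two states are related by $(R\cup R^{-1})^*$. For $n\ge 1$ let $[n]=\{0,\dots,n-1\}$; a random frame (or inverse tree) on $[n]$ of a given kind is uniformly distributed over all frames of that kind with set of states $[n]$. $\mathbf{GL.3}^{\mathbf{as}}$ is the set of formulas $\varphi$ such that the probability that $\varphi$ is valid in the random $\mathbf{GL.3}$-frame on $[n]$ tends to $1$ as $n\to\infty$. An inverse tree is a frame in which exactly one state $a_0$ has no successor, and every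 other state $a$ has exactly one successor and satisfies $aR^*a_0$. The distance $d_R(a,b)$ is the least $k\ge 0$ with $aR^kb$ (and is infinite if $b$ is not reachable from $a$); the height of a finite inverse tree is the maximum of its finite distances. Then: 1. $\mathbf{GL.3}^{\mathbf{as}}=\mathbf{GL.3}$. 2. For every $n\ge1$, the map $R\mapsto R^-:=R\setminus R^2$ is a bijection from the connected $\mathbf{GL.3}$-frames on $[n]$ onto the inverse trees on $[n]$. It preserves distances in the following sense: for all $a,b\in[n]$ and $k\ge 0$, $d_{R^-}(a,b)=k$ if and only if $k$ is the largest $j\geq 0$ with $aR^jb$, that is, the maximal length of an $R$-chain from $a$ to $b$. 3. There is a constant $q>0$ such that (a) for every $r\ge0$, the probability that the random inverse tree on $[n]$ has height greater than $r$ converges, as $n\to\infty$, to a limit that is at least $q$; (b) for every $r\ge1$, the probability that the random connected $\mathbf{GL.3}$-frame on $[n]$ has a subframe generated by a single state that is isomorphic to the irreflexive chain $(\{0,\dots,r-1\},<)$ converges, as $n\to\infty$, to a limit that is at least $q$. -/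

import Mathlib

open Filter Topology

noncomputable section

namespace ModalLogic

/-- Formulas of the basic modal language over the variables `p 0, p 1, …`,
with primitive connectives `→`, `⊥`, `□`. -/
inductive Formula : Type
  | var : ℕ → Formula
  | bot : Formula
  | imp : Formula → Formula → Formula
  | box : Formula → Formula

namespace Formula

/-- Negation. -/
def neg (φ : Formula) : Formula := imp φ bot

/-- Disjunction. -/
def or (φ ψ : Formula) : Formula := imp (neg φ) ψ

/-- Conjunction. -/
def and (φ ψ : Formula) : Formula := neg (imp φ (neg ψ))

/-- The formula obtained by replacing all occurrences of the variable `p` with `θ`. -/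
def subst (p : ℕ) (θ : Formula) : Formula → Formula
  | var q => if q = p then θ else var q
  | bot => bot
  | imp φ ψ => imp (subst p θ φ) (subst p θ ψ)
  | box φ => box (subst p θ φ)

/-- Truth value of a formula under a Boolean assignment `v` that treats variables and
boxed formulas as propositional atoms. -/
def boolEval (v : Formula → Prop) : Formula → Prop
  | var q => v (var q)
  | bot => False
  | imp φ ψ => boolEval v φ → boolEval v ψ
  | box φ => v (box φ)

/-- Propositional tautologies (in the modal language). -/
def IsTautology (φ : Formula) : Prop := ∀ v : Formula → Prop, boolEval v φ

end Formula

open Formula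

/-- Normal modal logics. -/
structure IsNormalLogic (L : Set Formula) : Prop where
  taut : ∀ φ, IsTautology φ → φ ∈ L
  normality : imp (box (imp (var 0) (var 1))) (imp (box (var 0)) (box (var 1))) ∈ L
  mp : ∀ φ ψ, φ ∈ L → imp φ ψ ∈ L → ψ ∈ L
  gen : ∀ φ, φ ∈ L → box φ ∈ L
  sub : ∀ φ p θ, φ ∈ L → subst p θ φ ∈ L

/-- The axiom `□(□p → p) → □p`. -/
def axiomLoeb : Formula := imp (box (imp (box (var 0)) (var 0))) (box (var 0))

/-- The axiom `□(p ∧ □p → q) ∨ □(q ∧ □q → p)`. -/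
def axiomDotThree : Formula :=
  or (box (imp (and (var 0) (box (var 0))) (var 1)))
    (box (imp (and (var 1) (box (var 1))) (var 0)))

/-- `GL.3`: the least normal modal logic containing `□(□p → p) → □p` and
`□(p ∧ □p → q) ∨ □(q ∧ □q → p)`. -/
def GL3 : Set Formula :=
  {φ | ∀ L : Set Formula, IsNormalLogic L → axiomLoeb ∈ L → axiomDotThree ∈ L → φ ∈ L}

/-- Kripke frames. -/
structure KripkeFrame where
  dom : Type
  rel : dom → dom → Prop
  nonempty : Nonempty dom

/-- Truth of a formula at a state of a model; `V q` is the set of states where `var q` holds. -/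
def Sat {X : Type} (R : X → X → Prop) (V : ℕ → X → Prop) : X → Formula → Prop
  | x, var q => V q x
  | _, bot => False
  | x, imp φ ψ => Sat R V x φ → Sat R V x ψ
  | x, box φ => ∀ y, R x y → Sat R V y φ

/-- Validity of a formula in a frame: truth at every state under every valuation. -/
def KripkeFrame.Valid (F : KripkeFrame) (φ : Formula) : Prop :=
  ∀ (V : ℕ → F.dom → Prop) (x : F.dom), Sat F.rel V x φ

/-- `Fr Γ`: the class of all frames in which every formula of `Γ` is valid. -/
def Fr (Γ : Set Formula) : Set KripkeFrame := {F | ∀ φ ∈ Γ, F.Valid φ}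

/-- A frame is connected if it has exactly one connected component, that is, any two states are
related by the reflexive transitive closure of `R ∪ R⁻¹` (the domain is nonempty). -/
def KripkeFrame.Connected (F : KripkeFrame) : Prop :=
  ∀ a b : F.dom, Relation.ReflTransGen (fun x y => F.rel x y ∨ F.rel y x) a b

/-- The class of all connected frames in `C`. -/
def conFrames (C : Set KripkeFrame) : Set KripkeFrame := {F | F ∈ C ∧ F.Connected}

/-- The labelled frames of the class `C` with set of states `{0, …, n - 1}`, each given by its
relation. For `n = 0` there are none, since frames are nonempty. -/
def labelled (n : ℕ) (C : Set KripkeFrame) : Set (Fin n → Fin n → Prop) :=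
  {R | ∃ h : Nonempty (Fin n), KripkeFrame.mk (Fin n) R h ∈ C}

/-- The probability that a uniformly distributed random element of the finite set `S`
belongs to `A`. -/
def uniformProb {α : Type} (S A : Set α) : ℝ := ((S ∩ A).ncard : ℝ) / (S.ncard : ℝ)

/-- The logic of almost sure validities of `C`: the formulas that are valid in the uniformly
random labelled `n`-state frame of `C` with probability tending to `1` as `n → ∞`. -/
def LogAs (C : Set KripkeFrame) : Set Formula :=
  {φ | Tendsto (fun n : ℕ => uniformProb (labelled n C) (labelled n (Fr {φ}))) atTop (𝓝 1)}

/-- The logic `L^as` of almost sure validities in the random frame of `L`. -/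
def asLogic (L : Set Formula) : Set Formula := LogAs (Fr L)

/-- The powers of a relation: `R^0` is equality and `R^(i+1) = R ∘ R^i`. -/
def relPow {X : Type} (R : X → X → Prop) : ℕ → X → X → Prop
  | 0 => fun a b => a = b
  | i + 1 => fun a b => ∃ c, R a c ∧ relPow R i c b

/-- The distance `min {k | a R^k b}`, which is `⊤` if `b` is not reachable from `a`. -/
def relDist {X : Type} (R : X → X → Prop) (a b : X) : ℕ∞ :=
  ⨅ (k : ℕ) (_ : relPow R k a b), (k : ℕ∞)

/-- Inverse trees: there is exactly one state `a₀` without successors, and every other state has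
exactly one successor and reaches `a₀`. -/
def IsInverseTree {X : Type} (R : X → X → Prop) : Prop :=
  ∃ a₀ : X, (∀ a, (∀ b, ¬ R a b) ↔ a = a₀) ∧
    ∀ a, a ≠ a₀ → (∃! b, R a b) ∧ Relation.ReflTransGen R a a₀

/-- The inverse trees with set of states `{0, …, n - 1}`. -/
def inverseTrees (n : ℕ) : Set (Fin n → Fin n → Prop) := {R | IsInverseTree R}

/-- The height: the maximal distance from a state to a state reachable from it. -/
def treeHeight {X : Type} (R : X → X → Prop) : ℕ∞ :=
  sSup {d | d ≠ ⊤ ∧ ∃ a b, d = relDist R a b}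

/-- The transitive reduction `R \ R²`. -/
def transReduction {X : Type} (R : X → X → Prop) : X → X → Prop :=
  fun a b => R a b ∧ ¬ relPow R 2 a b

/-- The relation of the subframe generated by the state `a`: the restriction of `R` to the
states reachable from `a`. -/
def generatedRel {X : Type} (R : X → X → Prop) (a : X) :
    {b : X // Relation.ReflTransGen R a b} → {b : X // Relation.ReflTransGen R a b} → Prop :=
  fun x y => R x.1 y.1

/-- Some point-generated subframe is isomorphic to the irreflexive chain with `r` states. -/
def HasGeneratedChain {X : Type} (r : ℕ) (R : X → X → Prop) : Prop :=
  ∃ a : X, Nonempty (generatedRel R a ≃r (fun i j : Fin r => i < j))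

end ModalLogic

end

open ModalLogic

open Filter Topology

noncomputable section

namespace ModalLogic

open Formula

/-! ### Derivations in `GL.3` -/

/-! A finite frame validates `GL3` exactly when it is a strict order in which the elements above any
given one form a chain (`mem_Fr_GL3_iff`). Such an order is the transitive closure of its reduction,
an acyclic relation with at most one successor per state; it is connected exactly when the reduction
is an inverse tree. In the reduction all paths between two states have the same length, so tree
distance equals maximal chain length.

Inverse trees are coded by self-maps with a fixed point that everything reaches, and forests by such
maps on `Option X` with root `none`. The decisive estimate is `ncard_shallowMaps_mul_factorial_le`:
a map of depth at most `r` on `N` points has a fibre with about `log N` elements. Stringing this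
fibre into a path, in any order, gives another rooted map; this map and the last point of the path
determine the original map and the order. With `d = log₂ N` the shallow proportion is at most `N /
d!`, which tends to `0`. Hence all limits in question are `1`.

A state with at least `r` proper successors has above or at it one with exactly `r`, which generates
a chain of `r + 1` states. So almost every `GL3`-frame contains a copy of any given finite chain. A
nontheorem is refuted in some finite chain, by a canonical model argument (`exists_chain_not_sat`),
hence in almost every frame, which gives `asLogic GL3 = GL3`. -/

theorem GL3.isNormalLogic : IsNormalLogic GL3 where
  taut φ h := fun _ hL _ _ => hL.taut φ h
  normality := fun _ hL _ _ => hL.normality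
  mp φ ψ h h' := fun L hL h1 h2 => hL.mp φ ψ (h L hL h1 h2) (h' L hL h1 h2)
  gen φ h := fun L hL h1 h2 => hL.gen φ (h L hL h1 h2)
  sub φ p θ h := fun L hL h1 h2 => hL.sub φ p θ (h L hL h1 h2)

theorem axiomLoeb_mem_GL3 : axiomLoeb ∈ GL3 := fun _ _ h _ => h

theorem axiomDotThree_mem_GL3 : axiomDotThree ∈ GL3 := fun _ _ _ h => h

/-- A strict upper bound of the variables of a formula. -/
def Formula.varBound : Formula → ℕ
  | var q => q + 1
  | bot => 0
  | imp φ ψ => max φ.varBound ψ.varBound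
  | box φ => φ.varBound

theorem Formula.subst_of_varBound_le {p : ℕ} {θ : Formula} :
    ∀ φ : Formula, φ.varBound ≤ p → subst p θ φ = φ
  | var q, h => by
    have : q ≠ p := by simp only [varBound] at h; omega
    simp [subst, this]
  | bot, _ => rfl
  | imp φ ψ, h => by
    simp only [varBound, max_le_iff] at h
    simp [subst, subst_of_varBound_le φ h.1, subst_of_varBound_le ψ h.2]
  | box φ, h => by
    simp only [varBound] at h
    simp [subst, subst_of_varBound_le φ h]

theorem GL3.normality_instance (α β : Formula) :
    imp (box (imp α β)) (imp (box α) (box β)) ∈ GL3 := by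
  have hN := GL3.isNormalLogic
  -- Substitution treats one variable at a time, so `var 1` is first renamed to a variable not in
  -- `α`; otherwise inserting `β` would alter `α`. The `+ 1` keeps the new variable distinct from
  -- `var 0`.
  have h1 := hN.sub _ 1 (var (α.varBound + 1)) hN.normality
  have h2 := hN.sub _ 0 α h1
  have h3 := hN.sub _ (α.varBound + 1) β h2
  simpa [subst, subst_of_varBound_le α (Nat.le_succ _)] using h3

theorem GL3.loeb_instance (α : Formula) : imp (box (imp (box α) α)) (box α) ∈ GL3 := by
  simpa [axiomLoeb, subst] using GL3.isNormalLogic.sub _ 0 α axiomLoeb_mem_GL3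

theorem GL3.dotThree_instance (α β : Formula) :
    or (box (imp (and α (box α)) β)) (box (imp (and β (box β)) α)) ∈ GL3 := by
  have hN := GL3.isNormalLogic
  have h1 := hN.sub _ 1 (var (α.varBound + 1)) axiomDotThree_mem_GL3
  have h2 := hN.sub _ 0 α h1
  have h3 := hN.sub _ (α.varBound + 1) β h2
  simpa [axiomDotThree, Formula.or, Formula.and, Formula.neg, subst,
    subst_of_varBound_le α (Nat.le_succ _)] using h3

/-- Sets of formulas that contain `GL.3` and are closed under modus ponens. -/
structure IsTheory (T : Set Formula) : Prop where
  subset : GL3 ⊆ T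
  mp : ∀ {α β}, α ∈ T → imp α β ∈ T → β ∈ T

theorem IsTheory.taut {T : Set Formula} (hT : IsTheory T) {α : Formula} (h : IsTautology α) :
    α ∈ T := hT.subset (GL3.isNormalLogic.taut α h)

theorem GL3.isTheory : IsTheory GL3 := ⟨subset_rfl, fun h h' => GL3.isNormalLogic.mp _ _ h h'⟩

/-- Complete consistent theories. -/
structure IsMaximalTheory (M : Set Formula) : Prop extends IsTheory M where
  bot_notMem : bot ∉ M
  mem_or : ∀ α, α ∈ M ∨ neg α ∈ M

theorem IsMaximalTheory.neg_mem_iff {M : Set Formula} (hM : IsMaximalTheory M) {α : Formula} :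
    neg α ∈ M ↔ α ∉ M :=
  ⟨fun h h' => hM.bot_notMem (hM.mp h' h), fun h => (hM.mem_or α).resolve_left h⟩

theorem IsMaximalTheory.imp_mem_iff {M : Set Formula} (hM : IsMaximalTheory M) {α β : Formula} :
    imp α β ∈ M ↔ (α ∈ M → β ∈ M) := by
  refine ⟨fun h h' => hM.mp h' h, fun h => ?_⟩
  by_cases hα : α ∈ M
  · exact hM.mp (h hα) (hM.taut fun v => by simp only [boolEval]; tauto)
  · exact hM.mp (hM.neg_mem_iff.2 hα) (hM.taut fun v => by simp only [neg, boolEval]; tauto)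

theorem IsMaximalTheory.or_mem_iff {M : Set Formula} (hM : IsMaximalTheory M) {α β : Formula} :
    or α β ∈ M ↔ (α ∈ M ∨ β ∈ M) := by
  rw [Formula.or, hM.imp_mem_iff, hM.neg_mem_iff]; tauto

theorem IsMaximalTheory.and_mem_iff {M : Set Formula} (hM : IsMaximalTheory M) {α β : Formula} :
    and α β ∈ M ↔ (α ∈ M ∧ β ∈ M) := by
  rw [Formula.and, hM.neg_mem_iff, hM.imp_mem_iff, hM.neg_mem_iff]; tauto

theorem IsTheory.exists_isMaximalTheory {T : Set Formula} (hT : IsTheory T) {φ : Formula}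
    (hφ : φ ∉ T) : ∃ M, T ⊆ M ∧ IsMaximalTheory M ∧ φ ∉ M := by
  obtain ⟨M, hTM, hM⟩ := zorn_subset_nonempty {T | IsTheory T ∧ φ ∉ T} (by
    intro c hc hchain hne
    refine ⟨⋃₀ c, ⟨⟨?_, ?_⟩, ?_⟩, fun s hs => Set.subset_sUnion_of_mem hs⟩
    · obtain ⟨s, hs⟩ := hne
      exact (hc hs).1.subset.trans (Set.subset_sUnion_of_mem hs)
    · rintro α β ⟨s, hs, hα⟩ ⟨t, ht, hαβ⟩
      rcases hchain.total hs ht with h | h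
      · exact ⟨t, ht, (hc ht).1.mp (h hα) hαβ⟩
      · exact ⟨s, hs, (hc hs).1.mp hα (h hαβ)⟩
    · rintro ⟨s, hs, h⟩
      exact (hc hs).2 h) T ⟨hT, hφ⟩
  obtain ⟨hMT, hφM⟩ := hM.prop
  -- The formulas that `α` implies over `M` form a theory containing `M` and `α`. By maximality this
  -- theory must contain `φ`.
  have key : ∀ α, α ∉ M → imp α φ ∈ M := by
    intro α hα
    by_contra hcon
    have hext : IsTheory {β | imp α β ∈ M} :=
      ⟨fun β hβ => hMT.mp (hMT.subset hβ) (hMT.taut fun v => by simp only [boolEval]; tauto),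
        fun {β γ} h h' => hMT.mp h' (hMT.mp h (hMT.taut fun v => by simp only [boolEval]; tauto))⟩
    have hsub := hM.le_of_ge (y := {β | imp α β ∈ M}) ⟨hext, hcon⟩
      (fun β hβ => hMT.mp hβ (hMT.taut fun v => by simp only [boolEval]; tauto))
    exact hα (hsub (hMT.taut (fun v => by simp only [boolEval]; tauto) : imp α α ∈ M))
  refine ⟨M, hTM, { hMT with bot_notMem := ?_, mem_or := ?_ }, hφM⟩
  · exact fun h => hφM (hMT.mp h (hMT.taut fun v => by simp only [boolEval]; tauto))
  · intro α
    by_contra hcon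
    push Not at hcon
    exact hφM (hMT.mp (key _ hcon.1) (hMT.mp (key _ hcon.2)
      (hMT.taut fun v => by simp only [neg, boolEval]; tauto)))

theorem IsTheory.box_mp {T : Set Formula} (hT : IsTheory T) {α β : Formula}
    (h : box α ∈ T) (h' : box (imp α β) ∈ T) : box β ∈ T :=
  hT.mp h (hT.mp h' (hT.subset (GL3.normality_instance α β)))

theorem IsTheory.box_mono {T : Set Formula} (hT : IsTheory T) {α β : Formula}
    (h : imp α β ∈ GL3) (h' : box α ∈ T) : box β ∈ T :=
  hT.box_mp h' (hT.subset (GL3.isNormalLogic.gen _ h))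

theorem GL3.imp_box_mono {α β : Formula} (h : imp α β ∈ GL3) : imp (box α) (box β) ∈ GL3 :=
  GL3.isTheory.mp (GL3.isNormalLogic.gen _ h) (GL3.normality_instance α β)

/-- Transitivity is derived from Löb's axiom, applied to `α ∧ □α`. -/
theorem IsTheory.box_box_mem {T : Set Formula} (hT : IsTheory T) {α : Formula}
    (h : box α ∈ T) : box (box α) ∈ T := by
  have h1 : imp (box (and α (box α))) (box α) ∈ GL3 :=
    GL3.imp_box_mono (GL3.isTheory.taut fun v => by simp only [Formula.and, neg, boolEval]; tauto)
  have h2 : imp α (imp (box (and α (box α))) (and α (box α))) ∈ GL3 :=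
    GL3.isTheory.mp h1
      (GL3.isTheory.taut fun v => by simp only [Formula.and, neg, boolEval]; tauto)
  have h3 := hT.mp (hT.box_mono h2 h) (hT.subset (GL3.loeb_instance _))
  exact hT.box_mono
    (GL3.isTheory.taut fun v => by simp only [Formula.and, neg, boolEval]; tauto) h3

/-! ### The canonical relation -/

/-- The accessibility relation of the canonical model. -/
def CanonicalRel (Γ Δ : Set Formula) : Prop := ∀ α, box α ∈ Γ → α ∈ Δ

theorem CanonicalRel.box_mem {Γ Δ : Set Formula} (hΓ : IsTheory Γ) (h : CanonicalRel Γ Δ)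
    {α : Formula} (hα : box α ∈ Γ) : box α ∈ Δ := h _ (hΓ.box_box_mem hα)

theorem CanonicalRel.trans {Γ Δ Θ : Set Formula} (hΓ : IsTheory Γ) (h : CanonicalRel Γ Δ)
    (h' : CanonicalRel Δ Θ) : CanonicalRel Γ Θ := fun _ hα => h' _ (h.box_mem hΓ hα)

/-- A refuted box has a refuting successor that is last with this property. -/
theorem IsTheory.exists_last_refuting {Γ : Set Formula} (hΓ : IsTheory Γ) {ψ : Formula}
    (hψ : box ψ ∉ Γ) : ∃ Δ, IsMaximalTheory Δ ∧ CanonicalRel Γ Δ ∧ box ψ ∈ Δ ∧ ψ ∉ Δ := by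
  have hT : IsTheory {α | box (imp (box ψ) α) ∈ Γ} := by
    refine ⟨fun α hα => ?_, fun {α β} h h' => ?_⟩
    · exact hΓ.box_mono (GL3.isTheory.taut fun v => by simp only [boolEval]; tauto)
        (hΓ.subset (GL3.isNormalLogic.gen _ hα))
    · exact hΓ.box_mp h (hΓ.box_mono
        (GL3.isTheory.taut fun v => by simp only [boolEval]; tauto) h')
  -- If this theory contained `ψ`, then `□(□ψ → ψ)` would be in `Γ`, and Löb would put `□ψ` there.
  obtain ⟨Δ, hsub, hΔ, hψΔ⟩ := hT.exists_isMaximalTheory (φ := ψ)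
    (fun h => hψ (hΓ.mp h (hΓ.subset (GL3.loeb_instance ψ))))
  refine ⟨Δ, hΔ, fun α hα => hsub ?_, hsub ?_, hψΔ⟩
  · exact hΓ.box_mono (GL3.isTheory.taut fun v => by simp only [boolEval]; tauto) hα
  · exact hΓ.subset (GL3.isNormalLogic.gen _
      (GL3.isTheory.taut fun v => by simp only [boolEval]; tauto))

theorem CanonicalRel.connected {Γ Δ Θ : Set Formula} (hΓ : IsMaximalTheory Γ)
    (hΔ : IsMaximalTheory Δ) (hΘ : IsMaximalTheory Θ) (h : CanonicalRel Γ Δ)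
    (h' : CanonicalRel Γ Θ) : Δ = Θ ∨ CanonicalRel Δ Θ ∨ CanonicalRel Θ Δ := by
  by_contra! hcon
  obtain ⟨hne, hΔΘ, hΘΔ⟩ := hcon
  obtain ⟨α, hαΔ, hαΘ⟩ : ∃ α, α ∈ Δ ∧ α ∉ Θ := by
    by_contra! hsub
    refine hne (Set.Subset.antisymm hsub fun α hα => ?_)
    by_contra hα'
    exact hΘ.neg_mem_iff.1 (hsub _ (hΔ.neg_mem_iff.2 hα')) hα
  simp only [CanonicalRel, not_forall] at hΔΘ hΘΔ
  obtain ⟨β, hβΔ, hβΘ⟩ := hΔΘ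
  obtain ⟨γ, hγΘ, hγΔ⟩ := hΘΔ
  have hbox : ∀ {T : Set Formula} (_ : IsTheory T) {δ ε : Formula}, box ε ∈ T →
      box (or δ ε) ∈ T := by
    intro T hT δ ε h
    exact hT.box_mono
      (GL3.isTheory.taut fun v => by simp only [Formula.or, neg, boolEval]; tauto) h
  -- Here `α` separates `Δ` from `Θ`, while `β` and `γ` witness the two failing relations. The first
  -- disjunct then fails at `Δ`, where neither `¬α` nor `γ` holds; the second fails at `Θ`, where
  -- neither `α` nor `β` holds.
  have hor := hΓ.subset (GL3.dotThree_instance (or α β) (or (neg α) γ))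
  rw [hΓ.or_mem_iff] at hor
  rcases hor with hor | hor
  · have := h _ hor
    rw [hΔ.imp_mem_iff, hΔ.and_mem_iff, hΔ.or_mem_iff, hΔ.or_mem_iff, hΔ.neg_mem_iff] at this
    have := this ⟨Or.inl hαΔ, hbox hΔ.toIsTheory hβΔ⟩
    tauto
  · have := h' _ hor
    rw [hΘ.imp_mem_iff, hΘ.and_mem_iff, hΘ.or_mem_iff, hΘ.or_mem_iff, hΘ.neg_mem_iff] at this
    have := this ⟨Or.inl hαΘ, hbox hΘ.toIsTheory hγΘ⟩
    tauto

/-! ### Completeness with respect to finite chains -/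

open Classical in
/-- The arguments of the boxed subformulas. -/
def Formula.boxArgs : Formula → Finset Formula
  | var _ => ∅
  | bot => ∅
  | imp φ ψ => φ.boxArgs ∪ ψ.boxArgs
  | box φ => insert φ φ.boxArgs

open Classical in
/-- The formulas of `B` whose boxes are refuted in `Γ`. -/
def refutedBoxes (B : Finset Formula) (Γ : Set Formula) : Finset Formula :=
  B.filter fun ψ => box ψ ∉ Γ

theorem mem_refutedBoxes {B : Finset Formula} {Γ : Set Formula} {ψ : Formula} :
    ψ ∈ refutedBoxes B Γ ↔ ψ ∈ B ∧ box ψ ∉ Γ := by simp [refutedBoxes]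

/-- A theory that refutes a box of `B` has a successor that either refutes `ψ` or still refutes
`□ψ`, for every box `□ψ` of `B` that the theory refutes, and that refutes fewer boxes of `B`. -/
theorem IsMaximalTheory.exists_next {B : Finset Formula} {Γ : Set Formula}
    (hΓ : IsMaximalTheory Γ) (hne : (refutedBoxes B Γ).Nonempty) :
    ∃ Δ, IsMaximalTheory Δ ∧ CanonicalRel Γ Δ ∧
      (refutedBoxes B Δ).card < (refutedBoxes B Γ).card ∧
      ∀ ψ ∈ B, box ψ ∉ Γ → ψ ∉ Δ ∨ box ψ ∉ Δ := by
  have hex : ∀ ψ, ψ ∈ refutedBoxes B Γ →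
      ∃ Δ, IsMaximalTheory Δ ∧ CanonicalRel Γ Δ ∧ box ψ ∈ Δ ∧ ψ ∉ Δ := fun ψ hψ =>
    hΓ.exists_last_refuting (mem_refutedBoxes.1 hψ).2
  choose! W hW hR hbox hnot using hex
  have hanti : ∀ {Θ Δ : Set Formula}, IsTheory Θ → CanonicalRel Θ Δ →
      refutedBoxes B Δ ⊆ refutedBoxes B Θ := fun hΘ h ψ hψ => by
    rw [mem_refutedBoxes] at hψ ⊢
    exact ⟨hψ.1, fun h' => hψ.2 (h.box_mem hΘ h')⟩
  -- The witness refuting the most boxes is the earliest one. A witness `W χ` strictly before it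
  -- would refute the same boxes and also `□ψ`.
  obtain ⟨ψ, hψ, hmax⟩ := Finset.exists_max_image _ (fun ψ => (refutedBoxes B (W ψ)).card) hne
  have hnotmem : ∀ Δ, box ψ ∈ Δ → ψ ∉ refutedBoxes B Δ := fun Δ h h' =>
    (mem_refutedBoxes.1 h').2 h
  refine ⟨W ψ, hW ψ hψ, hR ψ hψ, Finset.card_lt_card
    ⟨hanti hΓ.toIsTheory (hR ψ hψ), fun h => hnotmem _ (hbox ψ hψ) (h hψ)⟩, fun χ hχ hχΓ => ?_⟩
  have hχ' : χ ∈ refutedBoxes B Γ := mem_refutedBoxes.2 ⟨hχ, hχΓ⟩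
  rcases CanonicalRel.connected hΓ (hW ψ hψ) (hW χ hχ') (hR ψ hψ) (hR χ hχ') with h | h | h
  · exact Or.inl (h ▸ hnot χ hχ')
  · exact Or.inr fun h' => hnot χ hχ' (h _ h')
  · refine absurd (hmax χ hχ') (not_le.2 (Finset.card_lt_card
      ⟨hanti (hW χ hχ').toIsTheory h, fun h' => hnotmem _ (hbox ψ hψ) (h' ?_)⟩))
    exact mem_refutedBoxes.2 ⟨(mem_refutedBoxes.1 hψ).1, fun h' => hnot ψ hψ (h _ h')⟩

/-- Induction on the number of refuted boxes: `Γ` is prepended to a chain from the theory given by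
`exists_next`. A box refuted at `Γ` has its witness at that theory or inherits one further up. -/
theorem IsMaximalTheory.exists_chain (B : Finset Formula) (k : ℕ) :
    ∀ Γ, IsMaximalTheory Γ → (refutedBoxes B Γ).card ≤ k →
      ∃ (r : ℕ) (c : Fin (r + 1) → Set Formula), (∀ i, IsMaximalTheory (c i)) ∧ c 0 = Γ ∧
        (∀ i j, i < j → CanonicalRel (c i) (c j)) ∧
        ∀ i, ∀ ψ ∈ B, box ψ ∉ c i → ∃ j, i < j ∧ ψ ∉ c j := by
  induction k with
  | zero =>
    intro Γ hΓ hk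
    refine ⟨0, fun _ => Γ, fun _ => hΓ, rfl, fun i j hij => by omega, fun i ψ hψ h => ?_⟩
    have := mem_refutedBoxes.2 ⟨hψ, h⟩
    rw [Finset.card_eq_zero.1 (Nat.le_zero.1 hk)] at this
    simp at this
  | succ k ih =>
    intro Γ hΓ hk
    by_cases hne : (refutedBoxes B Γ).Nonempty
    · obtain ⟨Δ, hΔ, hΓΔ, hlt, hnext⟩ := hΓ.exists_next hne
      obtain ⟨r, c, hc, hc0, hrel, hwit⟩ := ih Δ hΔ (by omega)
      have hΓc : ∀ j, CanonicalRel Γ (c j) := by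
        intro j
        rcases eq_or_ne j 0 with rfl | hj
        · rwa [hc0]
        · exact hΓΔ.trans hΓ.toIsTheory (hc0 ▸ hrel 0 j (Fin.pos_iff_ne_zero.2 hj))
      refine ⟨r + 1, Fin.cons Γ c, ?_, rfl, ?_, ?_⟩
      · intro i
        cases i using Fin.cases with
        | zero => exact hΓ
        | succ i => exact hc i
      · intro i j hij
        cases j using Fin.cases with
        | zero => exact absurd hij (Fin.not_lt_zero i)
        | succ j =>
          cases i using Fin.cases with
          | zero => exact hΓc j
          | succ i => exact hrel i j (Fin.succ_lt_succ_iff.1 hij)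
      · intro i ψ hψ h
        cases i using Fin.cases with
        | zero =>
          rcases hnext ψ hψ h with h' | h'
          · exact ⟨Fin.succ 0, Fin.succ_pos _, by rw [Fin.cons_succ, hc0]; exact h'⟩
          · obtain ⟨j, -, hj⟩ := hwit 0 ψ hψ (by rwa [hc0])
            exact ⟨j.succ, Fin.succ_pos _, by rwa [Fin.cons_succ]⟩
        | succ i =>
          obtain ⟨j, hij, hj⟩ := hwit i ψ hψ h
          exact ⟨j.succ, Fin.succ_lt_succ_iff.2 hij, by rwa [Fin.cons_succ]⟩
    · exact ih Γ hΓ (by simp [Finset.not_nonempty_iff_eq_empty.1 hne])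

/-- The truth lemma. -/
theorem sat_chain_iff {r : ℕ} {B : Finset Formula} {c : Fin (r + 1) → Set Formula}
    (hc : ∀ i, IsMaximalTheory (c i)) (hrel : ∀ i j, i < j → CanonicalRel (c i) (c j))
    (hwit : ∀ i, ∀ ψ ∈ B, box ψ ∉ c i → ∃ j, i < j ∧ ψ ∉ c j) :
    ∀ φ : Formula, φ.boxArgs ⊆ B → ∀ i : Fin (r + 1),
      Sat (fun i j : Fin (r + 1) => i < j) (fun q i => var q ∈ c i) i φ ↔ φ ∈ c i
  | var q, _, i => Iff.rfl
  | bot, _, i => ⟨False.elim, (hc i).bot_notMem⟩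
  | imp φ ψ, h, i => by
    classical
    rw [boxArgs, Finset.union_subset_iff] at h
    rw [(hc i).imp_mem_iff, ← sat_chain_iff hc hrel hwit φ h.1 i,
      ← sat_chain_iff hc hrel hwit ψ h.2 i, Sat]
  | box φ, h, i => by
    classical
    rw [boxArgs, Finset.insert_subset_iff] at h
    have ih := sat_chain_iff hc hrel hwit φ h.2
    rw [Sat]
    refine ⟨fun hs => ?_, fun hφ j hij => (ih j).2 (hrel i j hij _ hφ)⟩
    by_contra hcon
    obtain ⟨j, hij, hj⟩ := hwit i φ h.1 hcon
    exact hj ((ih j).1 (hs j hij))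

/-- `GL.3` is complete with respect to finite irreflexive chains. -/
theorem exists_chain_not_sat {φ : Formula} (hφ : φ ∉ GL3) :
    ∃ (r : ℕ) (V : ℕ → Fin (r + 1) → Prop) (i : Fin (r + 1)),
      ¬ Sat (fun i j : Fin (r + 1) => i < j) V i φ := by
  obtain ⟨M, -, hM, hφM⟩ := GL3.isTheory.exists_isMaximalTheory hφ
  obtain ⟨r, c, hc, hc0, hrel, hwit⟩ := hM.exists_chain φ.boxArgs _ M le_rfl
  exact ⟨r, _, 0, fun h => hφM (hc0 ▸ (sat_chain_iff hc hrel hwit φ subset_rfl 0).1 h)⟩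

/-! ### Frames of `GL.3` -/

/-- Strict orders in which the elements above any given one form a chain. -/
structure IsForestOrder {X : Type} (R : X → X → Prop) : Prop where
  trans : ∀ {a b c}, R a b → R b c → R a c
  irrefl : ∀ a, ¬ R a a
  connected : ∀ {a b c}, R a b → R a c → b = c ∨ R b c ∨ R c b

theorem sat_subst {X : Type} (R : X → X → Prop) (V : ℕ → X → Prop) (p : ℕ) (θ : Formula) :
    ∀ (φ : Formula) (x : X), Sat R V x (subst p θ φ) ↔
      Sat R (Function.update V p fun y => Sat R V y θ) x φ
  | var q, x => by
    by_cases h : q = p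
    · subst h
      simp [subst, Sat]
    · simp [subst, Sat, h]
  | bot, _ => Iff.rfl
  | imp φ ψ, x => by
    rw [subst, Sat, Sat, sat_subst R V p θ φ x, sat_subst R V p θ ψ x]
  | box φ, x => by
    rw [subst, Sat, Sat]
    exact forall₂_congr fun y _ => sat_subst R V p θ φ y

theorem boolEval_sat {X : Type} (R : X → X → Prop) (V : ℕ → X → Prop) (x : X) :
    ∀ φ : Formula, boolEval (fun ψ => Sat R V x ψ) φ ↔ Sat R V x φ
  | var _ => Iff.rfl
  | bot => Iff.rfl
  | imp φ ψ => by rw [boolEval, Sat, boolEval_sat R V x φ, boolEval_sat R V x ψ]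
  | box _ => Iff.rfl

theorem KripkeFrame.isNormalLogic_valid (F : KripkeFrame) : IsNormalLogic {φ | F.Valid φ} where
  taut φ h V x := (boolEval_sat _ V x φ).1 (h _)
  normality _ _ h h' y hy := h y hy (h' y hy)
  mp _ _ h h' V x := h' V x (h V x)
  gen _ h V _ y _ := h V y
  sub φ p θ h V x := (sat_subst _ V p θ φ x).2 (h _ x)

theorem IsForestOrder.wellFounded_swap {X : Type} [Finite X] {R : X → X → Prop}
    (hR : IsForestOrder R) : WellFounded (fun a b => R b a) := by
  have : IsTrans X (fun a b => R b a) := ⟨fun _ _ _ h h' => hR.trans h' h⟩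
  have : Std.Irrefl (fun a b => R b a) := ⟨hR.irrefl⟩
  exact Finite.wellFounded_of_trans_of_irrefl _

theorem IsForestOrder.wellFounded {X : Type} [Finite X] {R : X → X → Prop}
    (hR : IsForestOrder R) : WellFounded R := by
  have : IsTrans X R := ⟨fun _ _ _ h h' => hR.trans h h'⟩
  have : Std.Irrefl R := ⟨hR.irrefl⟩
  exact Finite.wellFounded_of_trans_of_irrefl _

theorem mem_Fr_GL3_iff (F : KripkeFrame) [Finite F.dom] :
    F ∈ Fr GL3 ↔ IsForestOrder F.rel := by
  constructor
  · intro hF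
    have hL : F.Valid axiomLoeb := hF _ axiomLoeb_mem_GL3
    have hD : F.Valid axiomDotThree := hF _ axiomDotThree_mem_GL3
    refine ⟨fun {a b c} hab hbc => ?_, fun a haa => ?_, fun {a b c} hab hac => ?_⟩
    · by_contra hac
      -- If `a` does not see `c`, the premise of Löb holds at `a`: the only visible point falsifying
      -- the variable is `b`, and `b` sees `c`.
      refine hL (fun _ y => y ≠ b ∧ y ≠ c) a ?_ b hab |>.1 rfl
      intro y hay hbox
      refine ⟨?_, ?_⟩
      · rintro rfl
        exact (hbox c hbc).2 rfl
      · rintro rfl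
        exact hac hay
    · refine hL (fun _ y => y ≠ a) a ?_ a haa rfl
      rintro y - hbox rfl
      exact hbox y haa rfl
    · by_contra! hcon
      obtain ⟨hne, hbc, hcb⟩ := hcon
      -- Each variable holds at one of two incomparable points and at all its successors, so `b`
      -- refutes the first disjunct and `c` the second.
      have hor := hD (fun q y => if q = 0 then y = b ∨ F.rel b y else y = c ∨ F.rel c y) a
      have htrans : ∀ {x y z}, F.rel x y → F.rel y z → F.rel x z := by
        intro x y z hxy hyz
        by_contra hxz
        refine hL (fun _ w => w ≠ y ∧ w ≠ z) x ?_ y hxy |>.1 rfl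
        intro w hxw hbox
        refine ⟨?_, ?_⟩
        · rintro rfl
          exact (hbox z hyz).2 rfl
        · rintro rfl
          exact hxz hxw
      simp only [axiomDotThree, Formula.or, Formula.and, Formula.neg, Sat, if_true,
        one_ne_zero, if_false] at hor
      have hc := hor fun h => by
        have := h b hab fun h' => h' (Or.inl rfl) fun y hy => Or.inr hy
        tauto
      have := hc c hac fun h' => h' (Or.inl rfl) fun y hy => Or.inr hy
      rcases this with h | h
      · exact hne h.symm
      · exact hbc h
  · intro hR φ hφ
    refine hφ _ F.isNormalLogic_valid ?_ ?_
    · intro V x h y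
      -- Löb's axiom is induction from the top of a finite order downwards.
      refine hR.wellFounded_swap.induction (C := fun y => F.rel x y → V 0 y) y ?_
      intro y ih hxy
      exact h y hxy fun z hyz => ih z hyz (hR.trans hxy hyz)
    · intro V x
      simp only [axiomDotThree, Formula.or, Formula.and, Formula.neg, Sat]
      intro h z hxz hz
      by_contra hVz
      refine h fun y hxy hy => ?_
      by_contra hVy
      refine hz fun h1 h2 => hy fun h3 h4 => ?_
      rcases hR.connected hxy hxz with rfl | h' | h'
      · exact hVy h1
      · exact hVz (h4 _ h')
      · exact hVy (h2 _ h')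

theorem mem_labelled_Fr_GL3 {n : ℕ} {R : Fin n → Fin n → Prop} :
    R ∈ labelled n (Fr GL3) ↔ Nonempty (Fin n) ∧ IsForestOrder R := by
  constructor
  · rintro ⟨h, hR⟩
    have : Finite (KripkeFrame.mk (Fin n) R h).dom := inferInstanceAs (Finite (Fin n))
    exact ⟨h, (mem_Fr_GL3_iff _).1 hR⟩
  · rintro ⟨h, hR⟩
    have : Finite (KripkeFrame.mk (Fin n) R h).dom := inferInstanceAs (Finite (Fin n))
    exact ⟨h, (mem_Fr_GL3_iff _).2 hR⟩

/-! ### Generated chains -/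

/-- A frame that generates the chain with `r` states refutes all formulas refuted in the chain. -/
theorem HasGeneratedChain.exists_not_sat {X : Type} {R : X → X → Prop} {r : ℕ}
    (h : HasGeneratedChain r R) {φ : Formula} {V : ℕ → Fin r → Prop} {i : Fin r}
    (hφ : ¬ Sat (fun i j : Fin r => i < j) V i φ) :
    ∃ (W : ℕ → X → Prop) (x : X), ¬ Sat R W x φ := by
  obtain ⟨a, ⟨e⟩⟩ := h
  let W : ℕ → X → Prop := fun q x => ∃ h : Relation.ReflTransGen R a x, V q (e ⟨x, h⟩)
  have key : ∀ (ψ : Formula) (x : X) (h : Relation.ReflTransGen R a x),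
      Sat R W x ψ ↔ Sat (fun i j : Fin r => i < j) V (e ⟨x, h⟩) ψ := by
    intro ψ
    induction ψ with
    | var q => exact fun x h => ⟨fun ⟨_, h'⟩ => h', fun h' => ⟨h, h'⟩⟩
    | bot => exact fun x h => Iff.rfl
    | imp ψ χ ih ih' => exact fun x h => imp_congr (ih x h) (ih' x h)
    | box ψ ih =>
      intro x h
      constructor
      · intro hs j hj
        have hrel : generatedRel R a ⟨x, h⟩ (e.symm j) := by
          rw [← e.map_rel_iff, e.apply_symm_apply]
          exact hj
        have := (ih _ (e.symm j).2).1 (hs _ hrel)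
        rwa [Subtype.coe_eta, e.apply_symm_apply] at this
      · intro hs y hy
        exact (ih y (h.tail hy)).2 (hs _ ((e.map_rel_iff (a := ⟨x, h⟩) (b := ⟨y, h.tail hy⟩)).2 hy))
  refine ⟨W, (e.symm i).1, fun hs => hφ ?_⟩
  have := (key φ _ (e.symm i).2).1 hs
  rwa [Subtype.coe_eta, e.apply_symm_apply] at this

theorem IsForestOrder.exists_immediate {X : Type} [Finite X] {R : X → X → Prop}
    (hR : IsForestOrder R) {a b : X} (hab : R a b) :
    ∃ c, R a c ∧ ∀ d, R a d → d = c ∨ R c d := by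
  obtain ⟨c, hc, hmin⟩ := hR.wellFounded.has_min {c | R a c} ⟨b, hab⟩
  refine ⟨c, hc, fun d hd => ?_⟩
  rcases hR.connected hc hd with h | h | h
  · exact Or.inl h.symm
  · exact Or.inr h
  · exact absurd h (hmin d hd)

theorem IsForestOrder.ncard_lt {X : Type} [Finite X] {R : X → X → Prop}
    (hR : IsForestOrder R) {a b : X} (hab : R a b) : {c | R b c}.ncard < {c | R a c}.ncard :=
  Set.ncard_lt_ncard ⟨fun _ hc => hR.trans hab hc, fun h => hR.irrefl b (h hab)⟩ (Set.toFinite _)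

/-- Passing to the immediate successor removes only one element from the set of successors, so no
smaller cardinality is skipped. -/
theorem IsForestOrder.exists_ncard_eq {X : Type} [Finite X] {R : X → X → Prop}
    (hR : IsForestOrder R) {k : ℕ} (a : X) (ha : k ≤ {c | R a c}.ncard) :
    ∃ b, {c | R b c}.ncard = k := by
  refine hR.wellFounded_swap.induction
    (C := fun a => k ≤ {c | R a c}.ncard → ∃ b, {c | R b c}.ncard = k) a (fun a ih ha => ?_) ha
  rcases ha.eq_or_lt with h | h
  · exact ⟨a, h.symm⟩
  · obtain ⟨b, hb⟩ : {c | R a c}.Nonempty := Set.nonempty_of_ncard_ne_zero (by omega)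
    obtain ⟨c, hc, hmin⟩ := hR.exists_immediate hb
    refine ih c hc ?_
    have hsub : {d | R a d} ⊆ insert c {d | R c d} := fun d hd => hmin d hd
    have := (Set.ncard_le_ncard hsub (Set.toFinite _)).trans (Set.ncard_insert_le _ _)
    omega

theorem IsForestOrder.hasGeneratedChain {X : Type} [Finite X] {R : X → X → Prop}
    (hR : IsForestOrder R) {k : ℕ} (a : X) (ha : {c | R a c}.ncard = k) :
    HasGeneratedChain (k + 1) R := by
  classical
  have hiff : ∀ b, Relation.ReflTransGen R a b ↔ b = a ∨ R a b := by
    intro b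
    refine ⟨fun h => ?_, ?_⟩
    · induction h with
      | refl => exact Or.inl rfl
      | tail _ h ih =>
        rcases ih with rfl | ih
        · exact Or.inr h
        · exact Or.inr (hR.trans ih h)
    · rintro (rfl | h)
      · exact Relation.ReflTransGen.refl
      · exact Relation.ReflTransGen.single h
  have : IsStrictTotalOrder {b // Relation.ReflTransGen R a b} (generatedRel R a) :=
    { trichotomous := by
        rintro ⟨x, hx⟩ ⟨y, hy⟩ h h'
        simp only [generatedRel] at h h'
        rw [Subtype.mk.injEq]
        rcases (hiff x).1 hx with rfl | hx' <;> rcases (hiff y).1 hy with rfl | hy'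
        · rfl
        · exact absurd hy' h
        · exact absurd hx' h'
        · rcases hR.connected hx' hy' with h'' | h'' | h''
          · exact h''
          · exact absurd h'' h
          · exact absurd h'' h'
      irrefl := fun x => hR.irrefl x.1
      trans := fun x y z h h' => hR.trans h h' }
  let _ := linearOrderOfSTO (generatedRel R a)
  let _ : Fintype {b // Relation.ReflTransGen R a b} := Fintype.ofFinite _
  have hcard : Fintype.card {b // Relation.ReflTransGen R a b} = k + 1 := by
    rw [← Nat.card_eq_fintype_card]
    have : {b | Relation.ReflTransGen R a b} = insert a {c | R a c} := by
      ext b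
      exact hiff b
    rw [← ha, ← Set.ncard_insert_of_notMem (a := a) (s := {c | R a c}) (hR.irrefl a)
      (Set.toFinite _), ← this]
    exact Nat.card_coe_set_eq _
  exact ⟨a, ⟨(OrderIso.toRelIsoLT (monoEquivOfFin _ hcard)).symm⟩⟩

open Relation

/-! ### Transitive reductions of forest orders -/

/-- Acyclic relations in which every element has at most one successor. -/
structure IsInverseForest {X : Type} (S : X → X → Prop) : Prop where
  rightUnique : Relator.RightUnique S
  acyclic : ∀ a, ¬ TransGen S a a

section

variable {X : Type} {R S : X → X → Prop}

theorem IsForestOrder.transReduction_iff (hR : IsForestOrder R) {a b : X} :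
    transReduction R a b ↔ R a b ∧ ∀ c, R a c → c = b ∨ R b c := by
  refine and_congr_right fun hab => ⟨fun h c hac => ?_, ?_⟩
  · rcases hR.connected hab hac with h' | h' | h'
    · exact Or.inl h'.symm
    · exact Or.inr h'
    · exact absurd ⟨c, hac, b, h', rfl⟩ h
  · rintro h ⟨c, hac, b', hcb, rfl⟩
    rcases h c hac with rfl | h'
    · exact hR.irrefl _ hcb
    · exact hR.irrefl _ (hR.trans h' hcb)

theorem IsForestOrder.transGen_transReduction [Finite X] (hR : IsForestOrder R) :
    TransGen (transReduction R) = R := by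
  ext a b
  constructor
  · intro h
    induction h with
    | single h => exact h.1
    | tail _ h ih => exact hR.trans ih h.1
  · refine hR.wellFounded_swap.induction
      (C := fun a => R a b → TransGen (transReduction R) a b) a fun a ih hab => ?_
    obtain ⟨c, hac, hc⟩ := hR.exists_immediate hab
    have hred := hR.transReduction_iff.2 ⟨hac, hc⟩
    rcases hc b hab with rfl | hcb
    · exact TransGen.single hred
    · exact TransGen.head hred (ih c hac hcb)

theorem IsForestOrder.isInverseForest [Finite X] (hR : IsForestOrder R) :
    IsInverseForest (transReduction R) where
  rightUnique a b c hb hc := by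
    rw [hR.transReduction_iff] at hb hc
    rcases hc.2 b hb.1 with h | h
    · exact h
    · rcases hb.2 c hc.1 with h' | h'
      · exact h'.symm
      · exact absurd (hR.trans h h') (hR.irrefl _)
  acyclic a := by
    rw [hR.transGen_transReduction]
    exact hR.irrefl a

theorem IsInverseForest.isForestOrder (hS : IsInverseForest S) : IsForestOrder (TransGen S) where
  trans := TransGen.trans
  irrefl := hS.acyclic
  connected {a b c} hab hac := by
    rcases ReflTransGen.total_of_right_unique hS.rightUnique hab.to_reflTransGen
      hac.to_reflTransGen with h | h
    · rcases reflTransGen_iff_eq_or_transGen.1 h with h | h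
      · exact Or.inl h.symm
      · exact Or.inr (Or.inl h)
    · rcases reflTransGen_iff_eq_or_transGen.1 h with h | h
      · exact Or.inl h
      · exact Or.inr (Or.inr h)

/-- A path of at least two steps lies in the square of the closure. An edge lying in that square
would close a cycle, since both routes begin with the same unique successor. -/
theorem IsInverseForest.transReduction_transGen (hS : IsInverseForest S) :
    transReduction (TransGen S) = S := by
  ext a b
  constructor
  · rintro ⟨hab, hnot⟩
    obtain ⟨c, hac, hcb⟩ := TransGen.head'_iff.1 hab
    rcases reflTransGen_iff_eq_or_transGen.1 hcb with rfl | h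
    · exact hac
    · exact absurd ⟨c, TransGen.single hac, b, h, rfl⟩ hnot
  · refine fun h => ⟨TransGen.single h, ?_⟩
    rintro ⟨c, hac, b', hcb, rfl⟩
    obtain ⟨d, had, hdc⟩ := TransGen.head'_iff.1 hac
    obtain rfl := hS.rightUnique h had
    exact hS.acyclic _ (TransGen.trans_right hdc hcb)

/-! ### Inverse trees and connected forest orders -/

/-- Any two states are related by the reflexive transitive closure of `R ∪ R⁻¹`. -/
def IsConnectedRel (R : X → X → Prop) : Prop :=
  ∀ a b : X, ReflTransGen (fun x y => R x y ∨ R y x) a b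

/-- As successors are unique, a cycle through `a` also passes through every point reachable from
`a`. It would pass through the root, which has no successor. -/
theorem IsInverseTree.isInverseForest (hS : IsInverseTree S) : IsInverseForest S := by
  obtain ⟨a₀, hsink, htree⟩ := hS
  have hne : ∀ {a b}, S a b → a ≠ a₀ := fun {a b} h ha => (hsink a).2 ha b h
  have hU : Relator.RightUnique S := fun a b c hb hc => (htree a (hne hb)).1.unique hb hc
  refine ⟨hU, fun a ha => ?_⟩
  have hreach : ReflTransGen S a a₀ := by
    rcases eq_or_ne a a₀ with rfl | h
    · exact ReflTransGen.refl
    · exact (htree a h).2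
  have hcycle : TransGen S a₀ a₀ := by
    clear htree hne hsink
    induction hreach with
    | refl => exact ha
    | tail _ hbc ih =>
      obtain ⟨d, hbd, hdb⟩ := TransGen.head'_iff.1 ih
      obtain rfl := hU hbc hbd
      exact TransGen.tail' hdb hbc
  obtain ⟨b, hb, -⟩ := TransGen.head'_iff.1 hcycle
  exact hne hb rfl

theorem IsInverseTree.exists_root (hS : IsInverseTree S) :
    ∃ a₀, (∀ b, ¬ S a₀ b) ∧ ∀ a, ReflTransGen S a a₀ := by
  obtain ⟨a₀, hsink, htree⟩ := hS
  refine ⟨a₀, (hsink a₀).2 rfl, fun a => ?_⟩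
  rcases eq_or_ne a a₀ with rfl | h
  · exact ReflTransGen.refl
  · exact (htree a h).2

theorem IsInverseForest.isInverseTree (hS : IsInverseForest S) {a₀ : X} (hsink : ∀ b, ¬ S a₀ b)
    (hreach : ∀ a, ReflTransGen S a a₀) : IsInverseTree S := by
  have hsucc : ∀ a, a ≠ a₀ → ∃ b, S a b := by
    intro a ha
    rcases ReflTransGen.cases_head (hreach a) with h | ⟨b, hb, -⟩
    · exact absurd h ha
    · exact ⟨b, hb⟩
  refine ⟨a₀, fun a => ⟨fun h => ?_, fun h => h ▸ hsink⟩, fun a ha => ⟨?_, hreach a⟩⟩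
  · by_contra ha
    obtain ⟨b, hb⟩ := hsucc a ha
    exact h b hb
  · obtain ⟨b, hb⟩ := hsucc a ha
    exact ⟨b, hb, fun c hc => hS.rightUnique hc hb⟩

theorem IsInverseTree.isConnectedRel (hS : IsInverseTree S) : IsConnectedRel (TransGen S) := by
  obtain ⟨a₀, -, hreach⟩ := hS.exists_root
  intro a b
  have hup : ∀ x, ReflTransGen (fun x y => TransGen S x y ∨ TransGen S y x) x a₀ := fun x =>
    ReflTransGen.mono (fun _ _ h => Or.inl (TransGen.single h)) _ _ (hreach x)
  have : Std.Symm (fun x y => TransGen S x y ∨ TransGen S y x) := ⟨fun _ _ h => h.symm⟩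
  exact (hup a).trans (symm_of (ReflTransGen _) (hup b))

theorem IsForestOrder.isInverseTree [Finite X] [Nonempty X] (hR : IsForestOrder R)
    (hcon : IsConnectedRel R) : IsInverseTree (transReduction R) := by
  have hS := hR.isInverseForest
  have hle : ∀ {x y}, R x y → ReflTransGen (transReduction R) x y := by
    intro x y h
    rw [← hR.transGen_transReduction] at h
    exact h.to_reflTransGen
  obtain ⟨a₀, -, hmax⟩ := hR.wellFounded_swap.has_min Set.univ Set.univ_nonempty
  have hsink : ∀ b, ¬ transReduction R a₀ b := fun b hb => hmax b trivial hb.1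
  refine hS.isInverseTree hsink fun a => ?_
  -- Connectedness yields a common point above `a` and the sink, because upward paths from one state
  -- are comparable. Above the sink there is only the sink itself.
  obtain ⟨c, hac, hc⟩ : ∃ c, ReflTransGen (transReduction R) a c ∧
      ReflTransGen (transReduction R) a₀ c := by
    have h := hcon a₀ a
    induction h with
    | refl => exact ⟨a₀, ReflTransGen.refl, ReflTransGen.refl⟩
    | tail _ h ih =>
      obtain ⟨c, hbc, hc⟩ := ih
      rcases h with h | h
      · rcases ReflTransGen.total_of_right_unique hS.rightUnique (hle h) hbc with h' | h'
        · exact ⟨c, h', hc⟩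
        · exact ⟨_, ReflTransGen.refl, hc.trans h'⟩
      · exact ⟨c, (hle h).trans hbc, hc⟩
  rcases ReflTransGen.cases_head hc with rfl | ⟨b, hb, -⟩
  · exact hac
  · exact absurd hb (hsink b)

theorem mem_labelled_conFrames_Fr_GL3 {n : ℕ} {R : Fin n → Fin n → Prop} :
    R ∈ labelled n (conFrames (Fr GL3)) ↔
      Nonempty (Fin n) ∧ IsForestOrder R ∧ IsConnectedRel R := by
  constructor
  · rintro ⟨h, hR, hcon⟩
    exact ⟨h, (mem_labelled_Fr_GL3.1 ⟨h, hR⟩).2, hcon⟩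
  · rintro ⟨h, hR, hcon⟩
    obtain ⟨h', hR'⟩ := mem_labelled_Fr_GL3.2 ⟨h, hR⟩
    exact ⟨h', hR', hcon⟩

theorem bijOn_transReduction (n : ℕ) :
    Set.BijOn transReduction (labelled n (conFrames (Fr GL3))) (inverseTrees n) := by
  refine ⟨fun R hR => ?_, fun R hR R' hR' h => ?_, fun S hS => ?_⟩
  · obtain ⟨_, hR, hcon⟩ := mem_labelled_conFrames_Fr_GL3.1 hR
    exact hR.isInverseTree hcon
  · rw [← (mem_labelled_conFrames_Fr_GL3.1 hR).2.1.transGen_transReduction, h,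
      (mem_labelled_conFrames_Fr_GL3.1 hR').2.1.transGen_transReduction]
  · have hS' : IsInverseTree S := hS
    have hF := hS'.isInverseForest
    exact ⟨TransGen S, mem_labelled_conFrames_Fr_GL3.2
      ⟨⟨hS'.choose⟩, hF.isForestOrder, hS'.isConnectedRel⟩, hF.transReduction_transGen⟩

/-! ### Distances -/

theorem relPow_add {i j : ℕ} {a b c : X} (h : relPow R i a b) (h' : relPow R j b c) :
    relPow R (i + j) a c := by
  induction i generalizing a with
  | zero =>
    obtain rfl : a = b := h
    rwa [zero_add]
  | succ i ih =>
    obtain ⟨d, had, hdb⟩ := h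
    rw [Nat.succ_add]
    exact ⟨d, had, ih hdb⟩

theorem reflTransGen_of_relPow {i : ℕ} {a b : X} (h : relPow R i a b) : ReflTransGen R a b := by
  induction i generalizing a with
  | zero =>
    obtain rfl : a = b := h
    exact ReflTransGen.refl
  | succ i ih =>
    obtain ⟨d, had, hdb⟩ := h
    exact ReflTransGen.head had (ih hdb)

theorem exists_relPow_of_reflTransGen {a b : X} (h : ReflTransGen R a b) :
    ∃ i, relPow R i a b := by
  induction h using ReflTransGen.head_induction_on with
  | refl => exact ⟨0, rfl⟩
  | head h _ ih =>
    obtain ⟨i, hi⟩ := ih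
    exact ⟨i + 1, _, h, hi⟩

theorem relPow_mono (h : ∀ a b, R a b → S a b) {i : ℕ} {a b : X} (hab : relPow R i a b) :
    relPow S i a b := by
  induction i generalizing a with
  | zero => exact hab
  | succ i ih =>
    obtain ⟨d, had, hdb⟩ := hab
    exact ⟨d, h _ _ had, ih hdb⟩

theorem exists_relPow_of_relPow_transGen {j : ℕ} {a b : X} (h : relPow (TransGen S) j a b) :
    ∃ m, j ≤ m ∧ relPow S m a b := by
  induction j generalizing a with
  | zero => exact ⟨0, le_rfl, h⟩
  | succ j ih =>
    obtain ⟨c, hac, hcb⟩ := h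
    obtain ⟨m, hm, hcb⟩ := ih hcb
    obtain ⟨d, had, hdc⟩ := TransGen.head'_iff.1 hac
    obtain ⟨i, hi⟩ := exists_relPow_of_reflTransGen hdc
    exact ⟨i + m + 1, by omega, d, had, relPow_add hi hcb⟩

theorem IsInverseForest.relPow_unique (hS : IsInverseForest S) {i j : ℕ} {a b : X}
    (hi : relPow S i a b) (hj : relPow S j a b) : i = j := by
  induction i generalizing a j with
  | zero =>
    obtain rfl : a = b := hi
    cases j with
    | zero => rfl
    | succ j =>
      obtain ⟨c, hac, hca⟩ := hj
      exact absurd (TransGen.head' hac (reflTransGen_of_relPow hca)) (hS.acyclic a)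
  | succ i ih =>
    obtain ⟨c, hac, hcb⟩ := hi
    cases j with
    | zero =>
      obtain rfl : a = b := hj
      exact absurd (TransGen.head' hac (reflTransGen_of_relPow hcb)) (hS.acyclic a)
    | succ j =>
      obtain ⟨d, had, hdb⟩ := hj
      obtain rfl := hS.rightUnique hac had
      rw [ih hcb hdb]

theorem IsInverseForest.relDist_eq_iff (hS : IsInverseForest S) {a b : X} {k : ℕ} :
    relDist S a b = (k : ℕ∞) ↔ relPow S k a b := by
  have key : ∀ m, relPow S m a b → relDist S a b = (m : ℕ∞) := by
    intro m hm
    refine le_antisymm (iInf₂_le m hm) (le_iInf₂ fun j hj => ?_)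
    rw [hS.relPow_unique hm hj]
  refine ⟨fun h => ?_, key k⟩
  by_cases hex : ∃ m, relPow S m a b
  · obtain ⟨m, hm⟩ := hex
    rw [key m hm, Nat.cast_inj] at h
    exact h ▸ hm
  · push Not at hex
    simp [relDist, hex] at h

/-- Every `R`-chain refines to a path in the reduction that is at least as long, and all such paths
with the same ends have equal length. -/
theorem IsForestOrder.relDist_transReduction_eq_iff [Finite X] (hR : IsForestOrder R) {a b : X}
    {k : ℕ} : relDist (transReduction R) a b = (k : ℕ∞) ↔ IsGreatest {j | relPow R j a b} k := by
  have hS := hR.isInverseForest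
  have hle : ∀ a b, transReduction R a b → R a b := fun _ _ h => h.1
  have hex : ∀ j, relPow R j a b → ∃ m, j ≤ m ∧ relPow (transReduction R) m a b := by
    intro j hj
    refine exists_relPow_of_relPow_transGen ?_
    rwa [hR.transGen_transReduction]
  rw [hS.relDist_eq_iff]
  constructor
  · refine fun h => ⟨relPow_mono hle h, fun j hj => ?_⟩
    obtain ⟨m, hjm, hm⟩ := hex j hj
    rwa [hS.relPow_unique h hm]
  · rintro ⟨hk, hmax⟩
    obtain ⟨m, hkm, hm⟩ := hex k hk
    rwa [le_antisymm hkm (hmax (relPow_mono hle hm))]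

end

/-! ### Counting rooted maps of bounded depth -/

section

variable {α : Type}

/-- Self-maps with a fixed point in `P` that all elements reach under iteration. -/
def rootedMaps (P : Set α) : Set (α → α) :=
  {f | ∃ ρ ∈ P, f ρ = ρ ∧ ∀ x, ∃ k, f^[k] x = ρ}

/-- Self-maps with a fixed point in `P` that all elements reach in `r` steps. -/
def shallowMaps (P : Set α) (r : ℕ) : Set (α → α) :=
  {f | ∃ ρ ∈ P, f ρ = ρ ∧ ∀ x, f^[r] x = ρ}

open Classical in
/-- In a map of bounded depth on a large set, some fibre is large. -/
theorem exists_large_fibre [Fintype α] {f : α → α} {ρ : α} {r d : ℕ}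
    (hf : ∀ x, f^[r] x = ρ) (hd : d ^ r < Fintype.card α) :
    ∃ p, d ≤ (Finset.univ.filter fun x => f x = p ∧ x ≠ ρ).card := by
  by_contra! hcon
  -- The strict bound `< d` leaves room for `ρ`, which lies in its own fibre.
  have hfib : ∀ p, (Finset.univ.filter fun x => f x = p).card ≤ d := by
    intro p
    have hsub : (Finset.univ.filter fun x => f x = p) ⊆
        insert ρ (Finset.univ.filter fun x => f x = p ∧ x ≠ ρ) := by
      intro x hx
      simp only [Finset.mem_filter, Finset.mem_univ, true_and, Finset.mem_insert] at hx ⊢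
      tauto
    exact (Finset.card_le_card hsub).trans ((Finset.card_insert_le _ _).trans (hcon p))
  have hlevel : ∀ k, (Finset.univ.filter fun x => f^[k] x = ρ).card ≤ d ^ k := by
    intro k
    induction k with
    | zero =>
      rw [pow_zero, Finset.card_le_one]
      intro x hx y hy
      exact (Finset.mem_filter.1 hx).2.trans (Finset.mem_filter.1 hy).2.symm
    | succ k ih =>
      have := Finset.card_le_mul_card_image_of_maps_to (f := f)
        (s := Finset.univ.filter fun x => f^[k + 1] x = ρ)
        (t := Finset.univ.filter fun x => f^[k] x = ρ)
        (fun x hx => Finset.mem_filter.2 ⟨Finset.mem_univ _, (Finset.mem_filter.1 hx).2⟩) d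
        (fun p _ => (Finset.card_le_card fun x hx => by
          simp only [Finset.mem_filter, Finset.mem_univ, true_and] at hx ⊢
          exact hx.2).trans (hfib p))
      calc _ ≤ d * _ := this
        _ ≤ d * d ^ k := Nat.mul_le_mul_left d ih
        _ = d ^ (k + 1) := (pow_succ' d k).symm
  have := hlevel r
  simp only [hf, Finset.filter_true, Finset.card_univ] at this
  omega

open Classical in
/-- The map that sends `c (i + 1)` to `c i` and agrees with `f` elsewhere. -/
def stringFibre (f : α → α) {d : ℕ} (c : Fin d → α) (x : α) : α :=
  if h : ∃ i : Fin d, c i = x ∧ 0 < i.val then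
    c ⟨h.choose.val - 1, lt_of_le_of_lt (Nat.sub_le _ _) h.choose.isLt⟩
  else f x

variable {f f' : α → α} {m : ℕ} {c c' : Fin (m + 1) → α} {p p' ρ : α}

theorem stringFibre_succ (hc : c.Injective) {i : ℕ} (hi : i + 1 < m + 1) :
    stringFibre f c (c ⟨i + 1, hi⟩) = c ⟨i, by omega⟩ := by
  have h : ∃ j : Fin (m + 1), c j = c ⟨i + 1, hi⟩ ∧ 0 < j.val := ⟨_, rfl, Nat.succ_pos i⟩
  rw [stringFibre, dif_pos h]
  have := congrArg Fin.val (hc h.choose_spec.1)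
  congr 2
  simp only at this
  omega

theorem stringFibre_zero (hc : c.Injective) : stringFibre f c (c 0) = f (c 0) := by
  rw [stringFibre, dif_neg]
  rintro ⟨j, hj, hpos⟩
  rw [hc hj] at hpos
  exact absurd hpos (lt_irrefl 0)

theorem stringFibre_of_notMem {x : α} (hx : x ∉ Set.range c) : stringFibre f c x = f x := by
  rw [stringFibre, dif_neg]
  rintro ⟨j, hj, -⟩
  exact hx ⟨j, hj⟩

theorem iterate_stringFibre (hc : c.Injective) (i : ℕ) {j : ℕ} (h : j + i < m + 1) :
    (stringFibre f c)^[i] (c ⟨j + i, h⟩) = c ⟨j, by omega⟩ := by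
  induction i with
  | zero => rfl
  | succ i ih =>
    rw [Function.iterate_succ_apply]
    have : stringFibre f c (c ⟨j + (i + 1), h⟩) = c ⟨j + i, by omega⟩ :=
      stringFibre_succ hc (i := j + i) h
    rw [this, ih]

theorem iterate_stringFibre_eq (hc : c.Injective) (hp : ∀ i, f (c i) = p) (i : Fin (m + 1)) :
    (stringFibre f c)^[i.val + 1] (c i) = p := by
  have h : (stringFibre f c)^[i.val] (c i) = c 0 := by
    have := iterate_stringFibre (f := f) hc i.val (j := 0) (by omega)
    simpa using this
  rw [Function.iterate_succ_apply', h, stringFibre_zero hc, hp]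

/-- A map with constant values on the range of an injective tuple can be recovered from the
strung map and the last element of the tuple. -/
theorem eq_of_stringFibre_eq (hc : c.Injective) (hc' : c'.Injective) (hp : ∀ i, f (c i) = p)
    (hp' : ∀ i, f' (c' i) = p') (h : stringFibre f c = stringFibre f' c')
    (hlast : c (Fin.last m) = c' (Fin.last m)) : c = c' ∧ f = f' := by
  have hcc : c = c' := by
    ext ⟨j, hj⟩
    -- Iterating the strung map from the last point walks back through the whole tuple.
    have h1 := iterate_stringFibre (f := f) hc (m - j) (j := j) (by omega)
    have h2 := iterate_stringFibre (f := f') hc' (m - j) (j := j) (by omega)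
    have hm : (⟨j + (m - j), by omega⟩ : Fin (m + 1)) = Fin.last m := by
      ext
      simp only [Fin.val_last]
      omega
    rw [← h1, ← h2, hm, h, hlast]
  subst hcc
  refine ⟨rfl, ?_⟩
  have hpp : p = p' := by
    rw [← iterate_stringFibre_eq hc hp 0, ← iterate_stringFibre_eq hc hp' 0, h]
  ext x
  by_cases hx : x ∈ Set.range c
  · obtain ⟨i, rfl⟩ := hx
    rw [hp, hp', hpp]
  · rw [← stringFibre_of_notMem (f := f) hx, h, stringFibre_of_notMem hx]

/-- Stringing only delays the arrival of `c i` at `p`, from one step to `i + 1` steps. -/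
theorem stringFibre_reaches (hc : c.Injective) (hp : ∀ i, f (c i) = p) {k : ℕ} {x : α}
    (hx : f^[k] x = ρ) : ∃ j, (stringFibre f c)^[j] x = ρ := by
  induction k generalizing x with
  | zero => exact ⟨0, hx⟩
  | succ k ih =>
    obtain ⟨j, hj⟩ := ih hx
    by_cases hxc : x ∈ Set.range c
    · obtain ⟨i, rfl⟩ := hxc
      refine ⟨j + (i.val + 1), ?_⟩
      rw [Function.iterate_add_apply, iterate_stringFibre_eq hc hp, ← hp i, hj]
    · refine ⟨j + 1, ?_⟩
      rw [Function.iterate_succ_apply, stringFibre_of_notMem hxc, hj]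

theorem stringFibre_mem_rootedMaps {P : Set α} (hc : c.Injective) (hp : ∀ i, f (c i) = p)
    (hcρ : ∀ i, c i ≠ ρ) (hρ : ρ ∈ P) (hfρ : f ρ = ρ) (hreach : ∀ x, ∃ k, f^[k] x = ρ) :
    stringFibre f c ∈ rootedMaps P := by
  refine ⟨ρ, hρ, ?_, fun x => ?_⟩
  · rw [stringFibre_of_notMem, hfρ]
    rintro ⟨i, hi⟩
    exact hcρ i hi
  · obtain ⟨k, hk⟩ := hreach x
    exact stringFibre_reaches hc hp hk

theorem ncard_shallowMaps_mul_factorial_le [Fintype α] (P : Set α) {r m : ℕ}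
    (h : (m + 1) ^ r < Fintype.card α) :
    (shallowMaps P r).ncard * (m + 1).factorial ≤ (rootedMaps P).ncard * Fintype.card α := by
  classical
  have hex : ∀ f : shallowMaps P r, ∃ (ρ p : α) (e : Fin (m + 1) → α), ρ ∈ P ∧ f.1 ρ = ρ ∧
      (∀ x, f.1^[r] x = ρ) ∧ e.Injective ∧ (∀ i, f.1 (e i) = p) ∧ ∀ i, e i ≠ ρ := by
    rintro ⟨f, ρ, hρ, hfρ, hf⟩
    obtain ⟨p, hp⟩ := exists_large_fibre hf h
    rw [← Fintype.card_coe] at hp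
    have e : Fin (m + 1) ↪ _ := (Fin.castLEEmb hp).trans (Fintype.equivFin _).symm.toEmbedding
    have he := fun i => (Finset.mem_filter.1 (e i).2).2
    exact ⟨ρ, p, fun i => (e i).1, hρ, hfρ, hf, Subtype.val_injective.comp e.injective,
      fun i => (he i).1, fun i => (he i).2⟩
  choose ρ p e hρ hfρ hf he hp heρ using hex
  -- The permutation fixes the order of stringing; the `α`-component records the last point, the one
  -- datum needed for decoding.
  let F : shallowMaps P r × Equiv.Perm (Fin (m + 1)) → rootedMaps P × α := fun x =>
    (⟨stringFibre x.1.1 (e x.1 ∘ x.2),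
      stringFibre_mem_rootedMaps ((he x.1).comp x.2.injective) (fun i => hp x.1 _)
        (fun i => heρ x.1 _) (hρ x.1) (hfρ x.1) (fun y => ⟨r, hf x.1 y⟩)⟩,
      e x.1 (x.2 (Fin.last m)))
  have hF : F.Injective := by
    rintro ⟨f, σ⟩ ⟨f', σ'⟩ hFF
    simp only [F, Prod.mk.injEq, Subtype.mk.injEq] at hFF
    obtain ⟨hc, hff⟩ := eq_of_stringFibre_eq ((he f).comp σ.injective) ((he f').comp σ'.injective)
      (fun i => hp f _) (fun i => hp f' _) hFF.1 hFF.2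
    obtain rfl : f = f' := Subtype.ext hff
    refine Prod.ext rfl (Equiv.ext fun i => he f (congrFun hc i))
  have := Nat.card_le_card_of_injective F hF
  rwa [Nat.card_prod, Nat.card_prod, Nat.card_coe_set_eq, Nat.card_coe_set_eq, Nat.card_perm,
    Nat.card_fin, Nat.card_eq_fintype_card] at this

/-- The proportion of maps of depth at most `r` among the rooted maps on `N` elements tends to
`0`, uniformly in the set of possible roots. -/
theorem exists_tendsto_bound_shallowMaps (r : ℕ) : ∃ ε : ℕ → ℝ, (∀ N, 0 ≤ ε N) ∧
    Tendsto ε atTop (𝓝 0) ∧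
    ∀ᶠ N in atTop, ∀ (α : Type) [Fintype α], Fintype.card α = N → ∀ P : Set α,
      ((shallowMaps P r).ncard : ℝ) ≤ ε N * (rootedMaps P).ncard := by
  have hlog : Tendsto (Nat.log 2) atTop atTop := by
    refine tendsto_atTop.2 fun k => ?_
    filter_upwards [eventually_ge_atTop (2 ^ k)] with N hN
    exact Nat.le_log_of_pow_le one_lt_two hN
  -- With `d = Nat.log 2 N` the large fibre exists once `d ^ r < 2 ^ d ≤ N`, and `N < 2 ^ (d + 1)`
  -- bounds the ratio `N / d!`.
  refine ⟨fun N => 2 * ((2 : ℝ) ^ Nat.log 2 N / (Nat.log 2 N).factorial), fun N => by positivity,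
    ?_, ?_⟩
  · have := ((FloorSemiring.tendsto_pow_div_factorial_atTop (2 : ℝ)).comp hlog).const_mul 2
    simpa using this
  · have hpow : ∀ᶠ d : ℕ in atTop, d ^ r < 2 ^ d := by
      have := (isLittleO_pow_const_const_pow_of_one_lt (R := ℝ) r one_lt_two).bound
        (show (0 : ℝ) < 1 / 2 by norm_num)
      filter_upwards [this] with d hd
      have h2 : (0 : ℝ) < 2 ^ d := by positivity
      simp only [norm_pow, RCLike.norm_natCast, Real.norm_ofNat] at hd
      have : (d : ℝ) ^ r < 2 ^ d := by linarith
      exact_mod_cast this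
    filter_upwards [hlog.eventually hpow, hlog.eventually (eventually_ge_atTop 1),
      eventually_ge_atTop 1] with N hN h1 hN1 α _ hα P
    obtain ⟨m, hm⟩ : ∃ m, Nat.log 2 N = m + 1 := ⟨Nat.log 2 N - 1, by omega⟩
    have hle : 2 ^ (m + 1) ≤ N := hm ▸ Nat.pow_log_le_self 2 (by omega)
    have hlt : N < 2 ^ (m + 1 + 1) := hm ▸ Nat.lt_pow_succ_log_self one_lt_two N
    rw [hm] at hN
    have key := ncard_shallowMaps_mul_factorial_le P (r := r) (m := m) (by omega)
    have key' : ((shallowMaps P r).ncard : ℝ) * (m + 1).factorial ≤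
        (rootedMaps P).ncard * 2 ^ (m + 1 + 1) := by
      have h2 := key.trans (Nat.mul_le_mul_left _ (hα.trans_le hlt.le))
      exact_mod_cast h2
    simp only [hm]
    have hfac : (0 : ℝ) < (m + 1).factorial := by positivity
    rw [← le_div_iff₀ hfac] at key'
    refine key'.trans_eq ?_
    ring

end

/-! ### Random structures encoded by rooted maps -/

theorem tendsto_uniformProb_one {β : ℕ → Type} [∀ n, Finite (β n)] {T A : ∀ n, Set (β n)}
    {ε : ℕ → ℝ} (hε : Tendsto ε atTop (𝓝 0)) (hne : ∀ᶠ n in atTop, (T n).Nonempty)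
    (hle : ∀ᶠ n in atTop, ((T n \ A n).ncard : ℝ) ≤ ε n * (T n).ncard) :
    Tendsto (fun n => uniformProb (T n) (A n)) atTop (𝓝 1) := by
  have hlim : Tendsto (fun n => 1 - ε n) atTop (𝓝 1) := by simpa using hε.const_sub 1
  refine tendsto_of_tendsto_of_tendsto_of_le_of_le' hlim tendsto_const_nhds ?_ ?_
  · filter_upwards [hne, hle] with n hn hn'
    have hpos : (0 : ℝ) < (T n).ncard := by
      exact_mod_cast (Set.ncard_pos (Set.toFinite _)).2 hn
    have hsum : ((T n ∩ A n).ncard : ℝ) + (T n \ A n).ncard = (T n).ncard := by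
      exact_mod_cast Set.ncard_inter_add_ncard_sdiff_eq_ncard (T n) (A n) (Set.toFinite _)
    rw [uniformProb, le_div_iff₀ hpos]
    linarith
  · refine Eventually.of_forall fun n => div_le_one_of_le₀ ?_ (Nat.cast_nonneg _)
    exact_mod_cast Set.ncard_le_ncard Set.inter_subset_left (Set.toFinite _)

/-- If the structures in `T n` are parametrized by rooted maps and those outside `A n` only by
maps of bounded depth, then the random element of `T n` belongs to `A n` almost surely. -/
theorem tendsto_uniformProb_one_of_rootedMaps {α β : ℕ → Type} [∀ n, Fintype (α n)]
    [∀ n, Finite (β n)] (hcard : Tendsto (fun n => Fintype.card (α n)) atTop atTop)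
    {P : ∀ n, Set (α n)} (r : ℕ) {T A : ∀ n, Set (β n)} (F : ∀ n, (α n → α n) → β n)
    (hP : ∀ n, 1 ≤ n → (P n).Nonempty)
    (hmaps : ∀ n, 1 ≤ n → Set.MapsTo (F n) (rootedMaps (P n)) (T n))
    (hinj : ∀ n, Set.InjOn (F n) (rootedMaps (P n)))
    (hbad : ∀ n, T n \ A n ⊆ F n '' shallowMaps (P n) r) :
    Tendsto (fun n => uniformProb (T n) (A n)) atTop (𝓝 1) := by
  obtain ⟨ε, hε0, hε, hbound⟩ := exists_tendsto_bound_shallowMaps r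
  refine tendsto_uniformProb_one (hε.comp hcard) ?_ ?_
  · filter_upwards [eventually_ge_atTop 1] with n hn
    obtain ⟨ρ, hρ⟩ := hP n hn
    exact ⟨_, hmaps n hn (show (fun _ => ρ) ∈ rootedMaps (P n) from ⟨ρ, hρ, rfl, fun _ => ⟨1, rfl⟩⟩)⟩
  · filter_upwards [hcard.eventually hbound, eventually_ge_atTop 1] with n hn hn1
    have h1 : ((T n \ A n).ncard : ℝ) ≤ (shallowMaps (P n) r).ncard := by
      exact_mod_cast (Set.ncard_le_ncard (hbad n) (Set.toFinite _)).trans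
        (Set.ncard_image_le (Set.toFinite _))
    have h2 : ((rootedMaps (P n)).ncard : ℝ) ≤ (T n).ncard := by
      exact_mod_cast Set.ncard_le_ncard_of_injOn (F n) (hmaps n hn1) (hinj n) (Set.toFinite _)
    exact h1.trans ((hn _ rfl _).trans (mul_le_mul_of_nonneg_left h2 (hε0 _)))

section

variable {X : Type}

/-! ### Inverse trees as rooted maps -/

/-- The graph of a map without its loops. -/
def properGraph (f : X → X) (a b : X) : Prop := f a = b ∧ a ≠ b

/-- A deleted loop is still visible as the lack of an outgoing edge. -/
theorem properGraph_injective : Function.Injective (properGraph (X := X)) := by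
  have key : ∀ {f g : X → X} {a : X}, properGraph f = properGraph g → f a ≠ a → f a = g a := by
    intro f g a h ha
    have h' : properGraph f a (f a) := ⟨rfl, ha.symm⟩
    rw [h] at h'
    exact h'.1.symm
  intro f g h
  ext a
  by_cases hf : f a = a
  · by_cases hg : g a = a
    · rw [hf, hg]
    · exact (key h.symm hg).symm
  · exact key h hf

theorem isInverseTree_properGraph {f : X → X} (hf : f ∈ rootedMaps Set.univ) :
    IsInverseTree (properGraph f) := by
  obtain ⟨ρ, -, hfρ, hreach⟩ := hf
  have hsink : ∀ b, ¬ properGraph f ρ b := fun b h => h.2 (hfρ ▸ h.1)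
  have hacyc : ∀ k a, f^[k] a = ρ → ¬ TransGen (properGraph f) a a := by
    intro k
    induction k with
    | zero =>
      intro a ha h
      obtain rfl : a = ρ := ha
      obtain ⟨b, hb, -⟩ := TransGen.head'_iff.1 h
      exact hsink b hb
    | succ k ih =>
      intro a ha h
      obtain ⟨b, hb, hba⟩ := TransGen.head'_iff.1 h
      refine ih b ?_ (TransGen.tail' hba hb)
      rw [← hb.1]
      exact ha
  have hF : IsInverseForest (properGraph f) :=
    ⟨fun a b c hb hc => hb.1.symm.trans hc.1, fun a => (hreach a).elim fun k hk => hacyc k a hk⟩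
  have hto : ∀ k a, f^[k] a = ρ → ReflTransGen (properGraph f) a ρ := by
    intro k
    induction k with
    | zero =>
      intro a ha
      obtain rfl : a = ρ := ha
      exact ReflTransGen.refl
    | succ k ih =>
      intro a ha
      by_cases hfa : f a = a
      · refine ih a ?_
        rwa [Function.iterate_succ_apply, hfa] at ha
      · exact ReflTransGen.head ⟨rfl, Ne.symm hfa⟩ (ih (f a) ha)
  exact hF.isInverseTree hsink fun a => (hreach a).elim fun k hk => hto k a hk

theorem IsInverseTree.exists_eq_properGraph {S : X → X → Prop} (hS : IsInverseTree S) :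
    ∃ (f : X → X) (ρ : X), properGraph f = S ∧ f ρ = ρ ∧ ∀ a, ReflTransGen S a ρ := by
  classical
  have hF := hS.isInverseForest
  obtain ⟨ρ, hsink, hreach⟩ := hS.exists_root
  refine ⟨fun a => if h : ∃ b, S a b then h.choose else a, ρ, ?_, ?_, hreach⟩
  · ext a b
    by_cases h : ∃ b, S a b
    · simp only [properGraph, dif_pos h]
      constructor
      · rintro ⟨rfl, -⟩
        exact h.choose_spec
      · refine fun hab => ⟨hF.rightUnique h.choose_spec hab, ?_⟩
        rintro rfl
        exact hF.acyclic a (TransGen.single hab)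
    · simp only [properGraph, dif_neg h]
      constructor
      · rintro ⟨rfl, h'⟩
        exact absurd rfl h'
      · exact fun hab => absurd ⟨b, hab⟩ h
  · have h : ¬ ∃ b, S ρ b := fun ⟨b, hb⟩ => hsink b hb
    simp only [dif_neg h]

theorem iterate_of_relPow_properGraph {f : X → X} {m : ℕ} {a b : X}
    (h : relPow (properGraph f) m a b) : f^[m] a = b := by
  induction m generalizing a with
  | zero => exact h
  | succ m ih =>
    obtain ⟨c, hac, hcb⟩ := h
    rw [Function.iterate_succ_apply, hac.1]
    exact ih hcb

theorem mem_image_shallowMaps_of_treeHeight_le {S : X → X → Prop} (hS : IsInverseTree S) {r : ℕ}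
    (hr : ¬ (r : ℕ∞) < treeHeight S) : S ∈ properGraph '' shallowMaps Set.univ r := by
  obtain ⟨f, ρ, rfl, hfρ, hreach⟩ := hS.exists_eq_properGraph
  refine ⟨f, ⟨ρ, trivial, hfρ, fun x => ?_⟩, rfl⟩
  obtain ⟨m, hm⟩ := exists_relPow_of_reflTransGen (hreach x)
  have hdist := hS.isInverseForest.relDist_eq_iff.2 hm
  have hle : (m : ℕ∞) ≤ treeHeight (properGraph f) :=
    le_sSup ⟨ENat.natCast_ne_top m, x, ρ, hdist.symm⟩
  have hmr : m ≤ r := by exact_mod_cast hle.trans (not_lt.1 hr)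
  -- After `m` steps the root is reached, and the remaining steps stay there.
  obtain ⟨k, rfl⟩ := Nat.exists_eq_add_of_le' hmr
  rw [Function.iterate_add_apply, iterate_of_relPow_properGraph hm, Function.iterate_fixed hfρ]

/-- Connected forest orders without a generated chain with `r + 1` states come from maps of
bounded depth. -/
theorem mem_image_shallowMaps_of_isConnectedRel [Finite X] [Nonempty X] {R : X → X → Prop}
    (hR : IsForestOrder R) (hcon : IsConnectedRel R) {r : ℕ}
    (hr : ¬ HasGeneratedChain (r + 1) R) :
    R ∈ (fun f => TransGen (properGraph f)) '' shallowMaps Set.univ r := by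
  obtain ⟨f, ρ, hf, hfρ, hreach⟩ := (hR.isInverseTree hcon).exists_eq_properGraph
  refine ⟨f, ⟨ρ, trivial, hfρ, ?_⟩, ?_⟩
  -- Each step of `f` off the root strictly lowers the number of `R`-successors. If that number is
  -- at least `r` somewhere, a chain with `r + 1` states is generated.
  · have key : ∀ k x, {c | R x c}.ncard < k → f^[k] x = ρ := by
      intro k
      induction k with
      | zero => exact fun x hx => absurd hx (Nat.not_lt_zero _)
      | succ k ih =>
        intro x hx
        rcases ReflTransGen.cases_head (hreach x) with rfl | ⟨y, hxy, -⟩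
        · exact Function.iterate_fixed hfρ _
        · have hlt := hR.ncard_lt hxy.1
          rw [← hf] at hxy
          rw [Function.iterate_succ_apply, hxy.1]
          exact ih y (by omega)
    refine fun x => key r x ?_
    by_contra! hx
    obtain ⟨b, hb⟩ := hR.exists_ncard_eq x hx
    exact hr (hR.hasGeneratedChain b hb)
  · simp only [hf, hR.transGen_transReduction]

/-! ### Forest orders as rooted maps -/

/-- The relation on `X` induced by the graph of a map on `Option X`. -/
def someGraph (f : Option X → Option X) (a b : X) : Prop := f (some a) = some b

theorem isInverseForest_someGraph {f : Option X → Option X} (hf : f ∈ rootedMaps {none}) :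
    IsInverseForest (someGraph f) := by
  obtain ⟨ρ, rfl, -, hreach⟩ := hf
  have hacyc : ∀ k a, f^[k] (some a) = none → ¬ TransGen (someGraph f) a a := by
    intro k
    induction k with
    | zero => exact fun a ha => absurd ha (Option.some_ne_none a)
    | succ k ih =>
      intro a ha h
      obtain ⟨b, hb, hba⟩ := TransGen.head'_iff.1 h
      refine ih b ?_ (TransGen.tail' hba hb)
      have hb' : f (some a) = some b := hb
      rwa [Function.iterate_succ_apply, hb'] at ha
  refine ⟨fun a b c hb hc => ?_, fun a => (hreach (some a)).elim fun k hk => hacyc k a hk⟩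
  exact Option.some.inj ((show f (some a) = some b from hb).symm.trans hc)

theorem injOn_transGen_someGraph :
    Set.InjOn (fun f : Option X → Option X => TransGen (someGraph f)) (rootedMaps {none}) := by
  intro f hf g hg h
  have hfg : someGraph f = someGraph g := by
    rw [← (isInverseForest_someGraph hf).transReduction_transGen,
      ← (isInverseForest_someGraph hg).transReduction_transGen]
    exact congrArg transReduction h
  obtain ⟨_, rfl, hf0, -⟩ := hf
  obtain ⟨_, rfl, hg0, -⟩ := hg
  ext1 x
  cases x with
  | none => rw [hf0, hg0]
  | some a => exact Option.ext fun b => iff_of_eq (congrFun₂ hfg a b)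

theorem IsInverseForest.exists_eq_someGraph {S : X → X → Prop} (hS : IsInverseForest S) :
    ∃ f : Option X → Option X, someGraph f = S ∧ f none = none := by
  classical
  -- The extra point `none` is a common root to which all sinks of the forest are attached.
  refine ⟨fun x => x.elim none fun a => if h : ∃ b, S a b then some h.choose else none, ?_, rfl⟩
  ext a b
  by_cases h : ∃ b, S a b
  · simp only [someGraph, Option.elim_some, dif_pos h, Option.some_inj]
    exact ⟨fun h' => h' ▸ h.choose_spec, fun hab => hS.rightUnique h.choose_spec hab⟩
  · simp only [someGraph, Option.elim_some, dif_neg h]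
    exact ⟨fun h' => (Option.some_ne_none b h'.symm).elim, fun hab => absurd ⟨b, hab⟩ h⟩

/-- Forest orders without a generated chain with `r + 1` states come from maps of bounded
depth. -/
theorem mem_image_shallowMaps_of_isForestOrder [Finite X] {R : X → X → Prop}
    (hR : IsForestOrder R) {r : ℕ} (hr : ¬ HasGeneratedChain (r + 1) R) :
    R ∈ (fun f => TransGen (someGraph f)) '' shallowMaps {none} r := by
  obtain ⟨f, hf, hf0⟩ := hR.isInverseForest.exists_eq_someGraph
  refine ⟨f, ⟨none, rfl, hf0, ?_⟩, ?_⟩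
  · have key : ∀ k x, {c | R x c}.ncard < k → f^[k] (some x) = none := by
      intro k
      induction k with
      | zero => exact fun x hx => absurd hx (Nat.not_lt_zero _)
      | succ k ih =>
        intro x hx
        rw [Function.iterate_succ_apply]
        cases hfx : f (some x) with
        | none => exact Function.iterate_fixed hf0 _
        | some y =>
          have hxy : transReduction R x y := hf ▸ hfx
          have hlt := hR.ncard_lt hxy.1
          exact ih y (by omega)
    intro x
    cases x with
    | none => exact Function.iterate_fixed hf0 _
    | some x =>
      refine key r x ?_
      by_contra! hx
      obtain ⟨b, hb⟩ := hR.exists_ncard_eq x hx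
      exact hr (hR.hasGeneratedChain b hb)
  · simp only [hf, hR.transGen_transReduction]

end

/-! ### Almost sure properties -/

theorem tendsto_treeHeight (r : ℕ) : Tendsto
    (fun n : ℕ => uniformProb (inverseTrees n) {R | (r : ℕ∞) < treeHeight R}) atTop (𝓝 1) :=
  tendsto_uniformProb_one_of_rootedMaps (α := Fin) (by simp only [Fintype.card_fin]; exact tendsto_id) r
    (fun _ => properGraph) (P := fun _ => Set.univ)
    (fun n hn => ⟨⟨0, hn⟩, trivial⟩) (fun _ _ _ hf => isInverseTree_properGraph hf)
    (fun _ => properGraph_injective.injOn)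
    (fun _ _ hS => mem_image_shallowMaps_of_treeHeight_le hS.1 hS.2)

theorem tendsto_hasGeneratedChain_conFrames (r : ℕ) : Tendsto
    (fun n : ℕ => uniformProb (labelled n (conFrames (Fr GL3))) {R | HasGeneratedChain (r + 1) R})
    atTop (𝓝 1) := by
  refine tendsto_uniformProb_one_of_rootedMaps (α := Fin) (by simp only [Fintype.card_fin]; exact tendsto_id) r
    (fun _ f => TransGen (properGraph f)) (P := fun _ => Set.univ)
    (fun n hn => ⟨⟨0, hn⟩, trivial⟩) (fun n hn f hf => ?_) (fun n f hf g hg h => ?_)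
    (fun n R hR => ?_)
  · have hS := isInverseTree_properGraph hf
    exact mem_labelled_conFrames_Fr_GL3.2
      ⟨⟨0, hn⟩, hS.isInverseForest.isForestOrder, hS.isConnectedRel⟩
  · refine properGraph_injective ?_
    rw [← (isInverseTree_properGraph hf).isInverseForest.transReduction_transGen,
      ← (isInverseTree_properGraph hg).isInverseForest.transReduction_transGen]
    exact congrArg transReduction h
  · obtain ⟨_, hR', hcon⟩ := mem_labelled_conFrames_Fr_GL3.1 hR.1
    exact mem_image_shallowMaps_of_isConnectedRel hR' hcon hR.2

/-- The event is left general to serve both inclusions of `asLogic_GL3`: generating a given chain,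
and validating a given theorem. -/
theorem tendsto_uniformProb_labelled_Fr_GL3 (r : ℕ) {A : ∀ n, Set (Fin n → Fin n → Prop)}
    (hA : ∀ n, ∀ R ∈ labelled n (Fr GL3), HasGeneratedChain (r + 1) R → R ∈ A n) :
    Tendsto (fun n : ℕ => uniformProb (labelled n (Fr GL3)) (A n)) atTop (𝓝 1) := by
  refine tendsto_uniformProb_one_of_rootedMaps (α := fun n => Option (Fin n))
    (by simpa using tendsto_add_atTop_nat 1) r
    (fun _ f => TransGen (someGraph f)) (P := fun _ => {none})
    (fun n hn => ⟨none, rfl⟩)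
    (fun n hn f hf => mem_labelled_Fr_GL3.2
      ⟨⟨0, hn⟩, (isInverseForest_someGraph hf).isForestOrder⟩)
    (fun n => injOn_transGen_someGraph) (fun n R hR => ?_)
  exact mem_image_shallowMaps_of_isForestOrder (mem_labelled_Fr_GL3.1 hR.1).2
    fun h => hR.2 (hA n R hR.1 h)

theorem uniformProb_add_le_one {β : Type} [Finite β] {T A B : Set β}
    (h : ∀ x ∈ T, x ∈ A → x ∉ B) : uniformProb T A + uniformProb T B ≤ 1 := by
  rw [uniformProb, uniformProb, ← add_div]
  refine div_le_one_of_le₀ ?_ (Nat.cast_nonneg _)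
  have hdisj : Disjoint (T ∩ A) (T ∩ B) :=
    Set.disjoint_left.2 fun x hx hx' => h x hx.1 hx.2 hx'.2
  have := Set.ncard_union_eq hdisj (Set.toFinite _) (Set.toFinite _)
  have hle : (T ∩ A ∪ T ∩ B).ncard ≤ T.ncard :=
    Set.ncard_le_ncard (Set.union_subset Set.inter_subset_left Set.inter_subset_left)
      (Set.toFinite _)
  exact_mod_cast this ▸ hle

theorem asLogic_GL3 : asLogic GL3 = GL3 := by
  refine Set.Subset.antisymm (fun φ hφ => ?_) (fun φ hφ => ?_)
  · by_contra hcon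
    obtain ⟨r, V, i, hV⟩ := exists_chain_not_sat hcon
    have hchain := tendsto_uniformProb_labelled_Fr_GL3 r
      (A := fun _ => {R | HasGeneratedChain (r + 1) R}) fun _ _ _ h => h
    -- Validity of `φ` and generation of a chain refuting it exclude each other, so their
    -- probabilities cannot both tend to `1`.
    have hlim := Tendsto.add (show Tendsto _ _ _ from hφ) hchain
    have hle : (1 + 1 : ℝ) ≤ 1 := le_of_tendsto' hlim fun n => uniformProb_add_le_one ?_
    · norm_num at hle
    · rintro R - ⟨_, hR⟩ hRchain
      obtain ⟨W, x, hW⟩ := HasGeneratedChain.exists_not_sat hRchain hV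
      exact hW (hR φ rfl W x)
  · refine tendsto_uniformProb_labelled_Fr_GL3 0 fun n R hR _ => ?_
    obtain ⟨h, hR⟩ := hR
    refine ⟨h, fun ψ hψ => ?_⟩
    rw [Set.mem_singleton_iff.1 hψ]
    exact hR φ hφ

end ModalLogic

end

theorem theorem4p7 :
    -- the almost sure validities in the random finite GL.3-frame are exactly GL.3
    asLogic GL3 = GL3 ∧
    -- the transitive reduction is a bijection from the connected GL.3-frames to the inverse trees,
    -- and tree distances are the maximal lengths of chains in the GL.3-frame
    (∀ n : ℕ, 1 ≤ n →
      Set.BijOn transReduction (labelled n (conFrames (Fr GL3))) (inverseTrees n) ∧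
      ∀ R ∈ labelled n (conFrames (Fr GL3)), ∀ (a b : Fin n) (k : ℕ),
        relDist (transReduction R) a b = (k : ℕ∞) ↔ IsGreatest {j : ℕ | relPow R j a b} k) ∧
    -- heights of random inverse trees, and chains generated in random connected GL.3-frames
    (∃ q : ℝ, 0 < q ∧
      (∀ r : ℕ, ∃ l : ℝ, q ≤ l ∧
        Tendsto (fun n : ℕ => uniformProb (inverseTrees n) {R | (r : ℕ∞) < treeHeight R})
          atTop (𝓝 l)) ∧
      (∀ r : ℕ, 1 ≤ r → ∃ l : ℝ, q ≤ l ∧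
        Tendsto (fun n : ℕ => uniformProb (labelled n (conFrames (Fr GL3))) {R | HasGeneratedChain r R})
          atTop (𝓝 l))) := by
  -- The constant `q = 1` works, since every limit equals `1`.
  refine ⟨asLogic_GL3, fun n _ => ⟨bijOn_transReduction n, fun R hR a b k => ?_⟩, 1, one_pos,
    fun r => ⟨1, le_rfl, tendsto_treeHeight r⟩, fun r hr => ⟨1, le_rfl, ?_⟩⟩
  · exact (mem_labelled_conFrames_Fr_GL3.1 hR).2.1.relDist_transReduction_eq_iff
  · obtain ⟨r, rfl⟩ := Nat.exists_eq_add_of_le' hr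
    exact tendsto_hasGeneratedChain_conFrames r
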